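/- **Setting.** Let $d\ge 1$, let $(\Omega,\mathcal F,\mathbb P)$ be a probability space with a filtration $(\mathcal F_t)_{t\ge 0}$, and write $\|\cdot\|$, $\langle\cdot,\cdot\rangle$ for the Euclidean norm and inner product on $\mathbb R^d$ and $\mathbb S^{d-1}$ for the unit sphere. *The function $\psi$.* Let $\lambda_{\max}\in(0,\infty]$ and let $\psi:[0,\lambda_{\max})\to\mathbb R_{\ge 0}$ be CGF-like, i.e. twice continuously differentiable and strictly convex with $\psi(0)=\psi'(0)=0$ and $\psi''(0)>0$. Assume that $\psi$ is super-Gaussian, i.e. $\lambda\mapsto\psi(\lambda)/\lambda^2$ is nondecreasing on $(0,\lambda_{\max})$, and that $\sup_{\lambda\in[0,\lambda_{\max})}\psi'(\lambda)=\infty$. Let $\psi^*(u)=\sup_{\lambda\in[0,\lambda_{\max})}\{u\lambda-\psi(\lambda)\}$ for $u\ge 0$, and let $(\psi^*)^{-1}:[0,\infty)\to[0,\infty)$ be its inverse. *Sub-$\psi$ processes.* Adapted processes $(S_t)_{t\ge 0}$ in $\mathbb R$ and $(V_t)_{t\ge0}$ in $\mathbb R_{\ge 0}$ form a sub-$\psi$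 process if for every $\lambda\in[0,\lambda_{\max})$ there is a nonnegative supermartingale $(L^\lambda_t)_{t\ge 0}$ with respect to $(\mathcal F_t)$ with $\mathbb E L^\lambda_0\le 1$ and $\exp\{\lambda S_t-\psi(\lambda)V_t\}\le L_t^\lambda$ almost surely for all $t\ge0$. An adapted $\mathbb R^d$-valued process $(S_t)$ is sub-$\psi$ with an adapted positive semidefinite matrix-valued variance proxy $(V_t)$ if $(\langle\nu,S_t\rangle,\langle\nu,V_t\nu\rangle)_{t\ge 0}$ is sub-$\psi$ for every $\nu\in\mathbb S^{d-1}$. *The model.* Let $\theta^*\in\mathbb R^d$, let $(X_t)_{t\ge 1}$ be an $\mathbb R^d$-valued predictable sequence ($X_t$ is $\mathcal F_{t-1}$-measurable), let $(\epsilon_t)_{t\ge1}$ be real-valued and adapted, and let $Y_t=\langle X_t,\theta^*\rangle+\epsilon_t$. Assume that $S_t=\sum_{s=1}^t\epsilon_sX_s$ is sub-$\psi$ with variance proxy $V_t=\sum_{s=1}^tX_sX_s^\top$. *Notation.* For a symmetric positive semidefinite $V$ let $\gamma_{\min}(V),\gamma_{\max}(V)$ be its smallest and largest eigenvalues, $\kappa(V)=\gamma_{\max}(V)/\gamma_{\min}(V)$,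 and for $\rho>0$ let $V\vee\rho I_d$ be the matrix with the same eigenvectors in which each eigenvalue $\gamma$ is replaced by $\max\{\gamma,\rho\}$. Let $N_{d-1}(r)$ be the least cardinality of a subset $K$ of $\mathbb S^{d-1}$ such that every point of $\mathbb S^{d-1}$ is within Euclidean distance $r$ of $K$. Let $\mathbf X_t\in\mathbb R^{t\times d}$ have rows $X_1,\dots,X_t$, let $\mathbf Y_t=(Y_1,\dots,Y_t)^\top\in\mathbb R^t$, and define the least-squares estimate with shrinkage $$\hat\theta_t=(\mathbf X_t^\top\mathbf X_t\vee\rho I_d)^{-1}\mathbf X_t^\top\mathbf Y_t,\qquad t\ge1.$$ *Parameters.* Let $\alpha>1$, $\beta>1$, $\rho>0$, $\epsilon\in(0,1)$, $\delta\in(0,1)$, and let $h:[0,\infty)\to(0,\infty)$ be nondecreasing with $\sum_{k=0}^\infty h(k)^{-1}\le1$. Put $$L_\rho(V)=\log h\!\left(\log_\alpha\frac{\gamma_{\max}(V\vee\rho I_d)}{\rho}\right)+\log\!\left(\frac1\delta\cdot\frac1{1-\beta^{-1}}\right)+\log\!\left(\beta\sqrt{\kappa(V\vee\rho I_d)}\;N_{d-1}\!\left(\frac{\epsilon}{\beta\sqrt{\kappa(V\vee\rho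 I_d)}}\right)\right).$$ **Theorem.** With probability at least $1-\delta$, simultaneously for all $t\ge 1$, $$\left\|(V_t\vee\rho I_d)^{1/2}(\hat\theta_t-\theta^*)\right\|<\frac{\sqrt{\gamma_{\min}(V_t\vee\rho I_d)}}{1-\epsilon}\,(\psi^*)^{-1}\!\left(\frac{\alpha}{\gamma_{\min}(V_t\vee\rho I_d)}L_\rho(V_t)\right)+\sqrt\rho\,\|\theta^*\|\,\mathbf 1\{\gamma_{\min}(V_t)<\rho\}.$$ -/

import Mathlib

open MeasureTheory ProbabilityTheory Set
open scoped Matrix ENNReal NNReal RealInnerProductSpace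

noncomputable section

namespace OnlineRegression

/-! ### CGF-like functions, convex conjugates -/

/-- The interval `[0, lmax)`, where `lmax` is allowed to be `+∞`. -/
def dom (lmax : EReal) : Set ℝ := {l : ℝ | 0 ≤ l ∧ (l : EReal) < lmax}

/-- `ψ : [0, lmax) → ℝ≥0` is CGF-like: twice continuously differentiable, strictly convex,
`ψ 0 = ψ' 0 = 0` and `ψ'' 0 > 0` (one-sided derivatives at `0`). Only the values of `ψ` on
`[0, lmax)` matter. -/
structure IsCGFLike (lmax : EReal) (ψ : ℝ → ℝ) : Prop where
  lmax_pos : 0 < lmax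
  nonneg : ∀ l ∈ dom lmax, 0 ≤ ψ l
  contDiffOn : ContDiffOn ℝ 2 ψ (dom lmax)
  strictConvexOn : StrictConvexOn ℝ (dom lmax) ψ
  zero : ψ 0 = 0
  deriv_zero : derivWithin ψ (dom lmax) 0 = 0
  deriv2_zero : 0 < derivWithin (derivWithin ψ (dom lmax)) (dom lmax) 0

/-- `ψ` is super-Gaussian: `ψ(l) / l²` is nondecreasing on `(0, lmax)`. -/
def IsSuperGaussian (lmax : EReal) (ψ : ℝ → ℝ) : Prop :=
  MonotoneOn (fun l => ψ l / l ^ 2) (dom lmax \ {0})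

/-- `sup ψ' = ∞` over `[0, lmax)`. -/
def IsSteep (lmax : EReal) (ψ : ℝ → ℝ) : Prop :=
  ¬ BddAbove (derivWithin ψ (dom lmax) '' dom lmax)

/-- The convex conjugate `ψ*(u) = sup_{l ∈ [0, lmax)} (u l - ψ(l))`. -/
def conj (lmax : EReal) (ψ : ℝ → ℝ) (u : ℝ) : ℝ :=
  sSup ((fun l => u * l - ψ l) '' dom lmax)

/-- The inverse `(ψ*)⁻¹` of `ψ* : [0, ∞) → [0, ∞)`. -/
def conjInv (lmax : EReal) (ψ : ℝ → ℝ) : ℝ → ℝ :=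
  Function.invFunOn (conj lmax ψ) (Ici 0)

/-! ### Sub-`ψ` processes -/

/-- The scalar process `(S, V)` is sub-`ψ` with respect to the filtration `ℱ`: for each
`l ∈ [0, lmax)`, `exp (l S_t - ψ(l) V_t)` is almost surely dominated by a nonnegative
supermartingale with initial expectation at most one. -/
structure IsSubPsi {Ω : Type*} {mΩ : MeasurableSpace Ω} (P : Measure Ω) (ℱ : Filtration ℕ mΩ)
    (lmax : EReal) (ψ : ℝ → ℝ) (S V : ℕ → Ω → ℝ) : Prop where
  adapted_S : Adapted ℱ S
  adapted_V : Adapted ℱ V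
  nonneg_V : ∀ t ω, 0 ≤ V t ω
  dominated : ∀ l ∈ dom lmax, ∃ L : ℕ → Ω → ℝ, Supermartingale L ℱ P ∧
    (∀ t, ∀ᵐ ω ∂P, 0 ≤ L t ω) ∧ ∫ ω, L 0 ω ∂P ≤ 1 ∧
    ∀ t, ∀ᵐ ω ∂P, Real.exp (l * S t ω - ψ l * V t ω) ≤ L t ω

/-- The `ℝ^d`-valued process `S` is sub-`ψ` with (positive semidefinite matrix valued) variance
proxy `V`: every projection `(⟨ν, S_t⟩, ⟨ν, V_t ν⟩)`, `‖ν‖ = 1`, is sub-`ψ`. -/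
structure IsSubPsiVec {Ω : Type*} {mΩ : MeasurableSpace Ω} (P : Measure Ω) (ℱ : Filtration ℕ mΩ)
    (lmax : EReal) (ψ : ℝ → ℝ) {d : ℕ} (S : ℕ → Ω → EuclideanSpace ℝ (Fin d))
    (V : ℕ → Ω → Matrix (Fin d) (Fin d) ℝ) : Prop where
  adapted_S : Adapted ℱ S
  adapted_V : ∀ i j, Adapted ℱ (fun t ω => V t ω i j)
  posSemidef_V : ∀ t ω, (V t ω).PosSemidef
  proj : ∀ ν : EuclideanSpace ℝ (Fin d), ‖ν‖ = 1 →
    IsSubPsi P ℱ lmax ψ (fun t ω => ⟪ν, S t ω⟫) (fun t ω => ν.ofLp ⬝ᵥ (V t ω *ᵥ ν.ofLp))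

/-! ### Symmetric matrices -/

/-- The smallest eigenvalue of a symmetric matrix. -/
def gammaMin {d : ℕ} (V : Matrix (Fin d) (Fin d) ℝ) : ℝ := sInf (spectrum ℝ V)

/-- The largest eigenvalue of a symmetric matrix. -/
def gammaMax {d : ℕ} (V : Matrix (Fin d) (Fin d) ℝ) : ℝ := sSup (spectrum ℝ V)

/-- The condition number. -/
def kappa {d : ℕ} (V : Matrix (Fin d) (Fin d) ℝ) : ℝ := gammaMax V / gammaMin V

/-- `V ∨ ρ I`: the symmetric matrix obtained from the symmetric matrix `V` by replacing each
eigenvalue `γ` by `max γ ρ` and keeping the eigenvectors; see `vee_eq_sum`. -/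
def vee {d : ℕ} (V : Matrix (Fin d) (Fin d) ℝ) (ρ : ℝ) : Matrix (Fin d) (Fin d) ℝ :=
  cfc (fun x : ℝ => max x ρ) V

/-- The positive semidefinite square root of a positive semidefinite matrix. -/
def msqrt {d : ℕ} (V : Matrix (Fin d) (Fin d) ℝ) : Matrix (Fin d) (Fin d) ℝ :=
  cfc Real.sqrt V

theorem vee_eq_sum {d : ℕ} (V : Matrix (Fin d) (Fin d) ℝ) (hV : V.IsHermitian) (ρ : ℝ) :
    vee V ρ = ∑ n, max (hV.eigenvalues n) ρ •
      Matrix.vecMulVec (hV.eigenvectorBasis n).ofLp (hV.eigenvectorBasis n).ofLp := by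
  rw [vee, hV.cfc_eq, Matrix.IsHermitian.cfc, Unitary.conjStarAlgAut_apply]
  ext i j
  rw [Matrix.mul_apply, Matrix.sum_apply]
  refine Finset.sum_congr rfl fun n _ => ?_
  simp [Matrix.mul_diagonal, Matrix.vecMulVec_apply, Matrix.star_apply,
    Matrix.IsHermitian.eigenvectorUnitary_apply]
  ring

theorem msqrt_mul_self {d : ℕ} (V : Matrix (Fin d) (Fin d) ℝ) (hV : V.PosSemidef) :
    (msqrt V).PosSemidef ∧ msqrt V * msqrt V = V := by
  have hsa : IsSelfAdjoint V := hV.isHermitian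
  have hspec : ∀ x ∈ spectrum ℝ V, 0 ≤ x := by
    intro x hx
    rw [hV.isHermitian.spectrum_real_eq_range_eigenvalues] at hx
    obtain ⟨i, rfl⟩ := hx
    exact hV.eigenvalues_nonneg i
  constructor
  · rw [msqrt, hV.isHermitian.cfc_eq, Matrix.IsHermitian.cfc, Unitary.conjStarAlgAut_apply]
    refine Matrix.PosSemidef.mul_mul_conjTranspose_same ?_ _
    rw [Matrix.posSemidef_diagonal_iff]
    intro i
    simp [Real.sqrt_nonneg]
  · rw [msqrt, ← cfc_mul Real.sqrt Real.sqrt V]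
    conv_rhs => rw [← cfc_id ℝ V]
    exact cfc_congr fun x hx => Real.mul_self_sqrt (hspec x hx)

theorem gammaMin_isLeast {d : ℕ} (hd : 1 ≤ d) (V : Matrix (Fin d) (Fin d) ℝ)
    (hV : V.IsHermitian) : IsLeast (range hV.eigenvalues) (gammaMin V) := by
  have : Nonempty (Fin d) := ⟨⟨0, hd⟩⟩
  rw [gammaMin, hV.spectrum_real_eq_range_eigenvalues]
  have hf := finite_range hV.eigenvalues
  exact ⟨(range_nonempty _).csInf_mem hf, fun x hx => csInf_le hf.bddBelow hx⟩

theorem gammaMax_isGreatest {d : ℕ} (hd : 1 ≤ d) (V : Matrix (Fin d) (Fin d) ℝ)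
    (hV : V.IsHermitian) : IsGreatest (range hV.eigenvalues) (gammaMax V) := by
  have : Nonempty (Fin d) := ⟨⟨0, hd⟩⟩
  rw [gammaMax, hV.spectrum_real_eq_range_eigenvalues]
  have hf := finite_range hV.eigenvalues
  exact ⟨(range_nonempty _).csSup_mem hf, fun x hx => le_csSup hf.bddAbove hx⟩

/-! ### The boundary -/

/-- `N_{d-1}(ε)`: the smallest cardinality of an `ε`-cover of the unit sphere of `ℝ^d` by points
of the sphere. -/
def sphereCov (d : ℕ) (ε : ℝ) : ℕ :=
  (Metric.coveringNumber ε.toNNReal (Metric.sphere (0 : EuclideanSpace ℝ (Fin d)) 1)).toNat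

/-- The function `L_ρ(V)`. -/
def Lfun {d : ℕ} (α β ρ ε δ : ℝ) (h : ℝ → ℝ) (V : Matrix (Fin d) (Fin d) ℝ) : ℝ :=
  Real.log (h (Real.logb α (gammaMax (vee V ρ) / ρ)))
    + Real.log (1 / δ * (1 / (1 - β⁻¹)))
    + Real.log (β * √(kappa (vee V ρ)) * sphereCov d (ε / (β * √(kappa (vee V ρ)))))

/-- The boundary
`√γ_min(V ∨ ρI) / (1 - ε) · (ψ*)⁻¹(α / γ_min(V ∨ ρI) · L_ρ(V))`. -/
def boundary {d : ℕ} (lmax : EReal) (ψ : ℝ → ℝ) (α β ρ ε δ : ℝ) (h : ℝ → ℝ)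
    (V : Matrix (Fin d) (Fin d) ℝ) : ℝ :=
  √(gammaMin (vee V ρ)) / (1 - ε) *
    conjInv lmax ψ (α / gammaMin (vee V ρ) * Lfun α β ρ ε δ h V)

/-! ### Online linear regression -/

/-- The residual process `S_t = ∑_{s=1}^t ε_s X_s`. -/
def residual {Ω : Type*} {d : ℕ} (X : ℕ → Ω → EuclideanSpace ℝ (Fin d)) (η : ℕ → Ω → ℝ)
    (t : ℕ) (ω : Ω) : EuclideanSpace ℝ (Fin d) :=
  ∑ s ∈ Finset.Icc 1 t, η s ω • X s ω

/-- `V_t = ∑_{s=1}^t X_s X_sᵀ`. -/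
def gram {Ω : Type*} {d : ℕ} (X : ℕ → Ω → EuclideanSpace ℝ (Fin d))
    (t : ℕ) (ω : Ω) : Matrix (Fin d) (Fin d) ℝ :=
  ∑ s ∈ Finset.Icc 1 t, Matrix.vecMulVec (X s ω).ofLp (X s ω).ofLp

/-- The online linear regression model: `X` is predictable, the noise `η` is adapted,
`Y_t = ⟨X_t, θ⟩ + η_t`, and the residual process is sub-`ψ` with variance proxy `V_t`. Values at
time `0` play no role. -/
structure IsOnlineRegression {Ω : Type*} {mΩ : MeasurableSpace Ω} (P : Measure Ω)
    (ℱ : Filtration ℕ mΩ) (lmax : EReal) (ψ : ℝ → ℝ) {d : ℕ} (θ : EuclideanSpace ℝ (Fin d))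
    (X : ℕ → Ω → EuclideanSpace ℝ (Fin d)) (η Y : ℕ → Ω → ℝ) : Prop where
  predictable_X : ∀ t, Measurable[ℱ t] (X (t + 1))
  adapted_noise : ∀ t, 1 ≤ t → Measurable[ℱ t] (η t)
  response : ∀ t, 1 ≤ t → ∀ ω, Y t ω = ⟪X t ω, θ⟫ + η t ω
  subPsi : IsSubPsiVec P ℱ lmax ψ (residual X η) (gram X)

/-- The design matrix, with rows `X_1, …, X_t`. -/
def design {Ω : Type*} {d : ℕ} (X : ℕ → Ω → EuclideanSpace ℝ (Fin d))
    (t : ℕ) (ω : Ω) : Matrix (Fin t) (Fin d) ℝ :=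
  Matrix.of fun s i => X (s + 1) ω i

/-- The response vector `(Y_1, …, Y_t)`. -/
def responses {Ω : Type*} (Y : ℕ → Ω → ℝ) (t : ℕ) (ω : Ω) : Fin t → ℝ :=
  fun s => Y (s + 1) ω

theorem gram_eq {Ω : Type*} {d : ℕ} (X : ℕ → Ω → EuclideanSpace ℝ (Fin d)) (t : ℕ) (ω : Ω) :
    (design X t ω)ᵀ * design X t ω = gram X t ω := by
  ext i j
  simp only [gram, design, Matrix.mul_apply, Matrix.sum_apply, Matrix.transpose_apply,
    Matrix.of_apply, Matrix.vecMulVec_apply]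
  rw [Fin.sum_univ_eq_sum_range (fun s => (X (s + 1) ω).ofLp i * (X (s + 1) ω).ofLp j) t,
    Finset.range_eq_Ico, Finset.sum_Ico_add' (fun s => (X s ω).ofLp i * (X s ω).ofLp j) 0 t 1]
  rfl

/-- The least squares estimate with shrinkage
`θ̂_t = (𝐗_tᵀ𝐗_t ∨ ρI)⁻¹ 𝐗_tᵀ 𝐘_t`. -/
def estimate {Ω : Type*} {d : ℕ} (ρ : ℝ) (X : ℕ → Ω → EuclideanSpace ℝ (Fin d)) (Y : ℕ → Ω → ℝ)
    (t : ℕ) (ω : Ω) : EuclideanSpace ℝ (Fin d) :=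
  WithLp.toLp 2 ((vee ((design X t ω)ᵀ * design X t ω) ρ)⁻¹ *ᵥ
    ((design X t ω)ᵀ *ᵥ responses Y t ω))

end OnlineRegression

end

/-! The error splits (`estimate_sub_eq`) into a noise term `(V ∨ ρI)⁻¹ S` and a shrinkage bias.
After multiplication by `(V ∨ ρI)^{1/2}` the bias operator is a function of `V` that vanishes at
eigenvalues `≥ ρ` and is at most `√ρ` elsewhere (`norm_shrinkage_bias_le`), which gives the
indicator term.

For the noise, put `A = (V ∨ ρI)^{1/2}` and `u = (V ∨ ρI)⁻¹ S`, so that `⟪A ν, A u⟫ = ⟪ν, S⟫`. A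
cover of the sphere whose radius is `ε/√κ` or finer contains a `ν` with `(1 - ε) ‖A ν‖ ‖A u‖ ≤ ⟪ν,
S⟫` (`exists_cover_inner_ge`). It remains to bound `⟪ν, S⟫` for finitely many directions at each
resolution.

For a fixed direction and slope, Ville's inequality keeps the process below a line at all times.
Slopes are tuned to the variance scales `ρ α^(k+1)`, and super-Gaussianity transfers the line bound
at a scale to any variance within a factor `α` below it, in terms of `γ_min` alone
(`IsCGFLike.lt_sqrt_mul_of_line`). Both `κ` and the variance are random, so a union bound runs over
resolutions `j` and scales `k`, with weights `(1 - β⁻¹) β⁻ʲ` and `1 / h k`; the `level` of each pair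
is chosen so that the total failure probability is at most `δ`, and `L_ρ` dominates the level of the
pair used at time `t`. -/

namespace OnlineRegression

/-! ### Maximal inequalities -/

/-- **Ville's inequality** for almost surely nonnegative supermartingales. -/
theorem measure_exists_ge_le_of_supermartingale {Ω : Type*} {mΩ : MeasurableSpace Ω}
    {P : Measure Ω} [IsProbabilityMeasure P] {ℱ : Filtration ℕ mΩ} {L : ℕ → Ω → ℝ}
    (hL : Supermartingale L ℱ P) (hnn : ∀ t, ∀ᵐ ω ∂P, 0 ≤ L t ω) (h0 : ∫ ω, L 0 ω ∂P ≤ 1)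
    {c : ℝ} (hc : 0 < c) : P {ω | ∃ t, c ≤ L t ω} ≤ ENNReal.ofReal c⁻¹ := by
  have hfin : ∀ N : ℕ, P {ω | ∃ t ≤ N, c ≤ L t ω} ≤ ENNReal.ofReal c⁻¹ := by
    intro N
    -- `hittingBtwn` takes the value `N` when the level is not reached, so `τ` is bounded and
    -- optional stopping applies.
    set τ : Ω → ℕ∞ := fun ω => (hittingBtwn L {y : ℝ | c ≤ y} 0 N ω : ℕ) with hτ_def
    have hτ : IsStoppingTime ℱ τ :=
      hL.stronglyAdapted.adapted.isStoppingTime_hittingBtwn measurableSet_Ici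
    have hbdd : ∀ ω, τ ω ≤ N := fun ω => Nat.cast_le.2 (hittingBtwn_le ω)
    have hint : Integrable (stoppedValue L τ) P := by
      have := hL.neg.integrable_stoppedValue hτ hbdd
      convert this.neg using 1
      ext ω; simp [stoppedValue]
    have hmean : ∫ ω, stoppedValue L τ ω ∂P ≤ 1 := by
      -- Optional stopping for the submartingale `-L` between the times `0` and `τ`.
      have := hL.neg.expected_stoppedValue_mono (isStoppingTime_const ℱ 0) hτ
        (fun ω => zero_le) hbdd
      have e1 : stoppedValue (-L) τ = fun ω => -stoppedValue L τ ω := by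
        ext ω; simp [stoppedValue]
      have e2 : stoppedValue (-L) (fun _ => ((0 : ℕ) : ℕ∞)) = fun ω => -L 0 ω := by
        ext ω; rfl
      rw [e1] at this
      have h2 := e2 ▸ this
      rw [integral_neg, integral_neg] at h2
      linarith
    have hpos : 0 ≤ᵐ[P] stoppedValue L τ := by
      filter_upwards [ae_all_iff.2 hnn] with ω hω
      exact hω _
    have hsub : {ω | ∃ t ≤ N, c ≤ L t ω} ⊆ {ω | c ≤ stoppedValue L τ ω} := by
      rintro ω ⟨t, htN, ht⟩
      exact stoppedValue_hittingBtwn_mem (s := {y : ℝ | c ≤ y}) ⟨t, ⟨Nat.zero_le _, htN⟩, ht⟩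
    have hmarkov := mul_meas_ge_le_integral_of_nonneg hpos hint c
    refine (measure_mono hsub).trans ?_
    rw [ENNReal.le_ofReal_iff_toReal_le (measure_ne_top _ _) (by positivity)]
    rw [← Measure.real, ← mul_le_mul_iff_right₀ hc, mul_inv_cancel₀ hc.ne']
    exact hmarkov.trans hmean
  have hU : {ω | ∃ t, c ≤ L t ω} = ⋃ N : ℕ, {ω | ∃ t ≤ N, c ≤ L t ω} := by
    ext ω
    simp only [mem_ofPred_eq, mem_iUnion]
    exact ⟨fun ⟨t, ht⟩ => ⟨t, t, le_rfl, ht⟩, fun ⟨_, t, _, ht⟩ => ⟨t, ht⟩⟩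
  rw [hU, Monotone.measure_iUnion]
  · exact iSup_le hfin
  · rintro a b hab ω ⟨t, hta, ht⟩
    exact ⟨t, hta.trans hab, ht⟩

/-- Line crossing inequality for scalar sub-`ψ` processes. -/
theorem IsSubPsi.measure_exists_ge_le {Ω : Type*} {mΩ : MeasurableSpace Ω} {P : Measure Ω}
    [IsProbabilityMeasure P] {ℱ : Filtration ℕ mΩ} {lmax : EReal} {ψ : ℝ → ℝ}
    {S V : ℕ → Ω → ℝ} (hS : IsSubPsi P ℱ lmax ψ S V) {l : ℝ} (hl : l ∈ dom lmax) (x : ℝ) :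
    P {ω | ∃ t, x ≤ l * S t ω - ψ l * V t ω} ≤ ENNReal.ofReal (Real.exp (-x)) := by
  obtain ⟨L, hL, hnn, h0, hdom⟩ := hS.dominated l hl
  rw [Real.exp_neg]
  refine le_trans (measure_mono_ae ?_)
    (measure_exists_ge_le_of_supermartingale hL hnn h0 (Real.exp_pos x))
  filter_upwards [ae_all_iff.2 hdom] with ω hω
  rintro ⟨t, ht⟩
  exact ⟨t, (Real.exp_le_exp.2 ht).trans (hω t)⟩

/-! ### The convex conjugate -/

theorem zero_mem_dom {lmax : EReal} (h : 0 < lmax) : (0 : ℝ) ∈ dom lmax := ⟨le_rfl, by simpa⟩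

theorem dom_of_le {lmax : EReal} {a b : ℝ} (hb : b ∈ dom lmax) (ha : 0 ≤ a) (hab : a ≤ b) :
    a ∈ dom lmax :=
  ⟨ha, lt_of_le_of_lt (EReal.coe_le_coe_iff.2 hab) hb.2⟩

theorem ordConnected_dom (lmax : EReal) : (dom lmax).OrdConnected :=
  ⟨fun _ ha _ hb _ hx => dom_of_le hb (ha.1.trans hx.1) hx.2⟩

theorem exists_pos_mem_dom {lmax : EReal} (h : 0 < lmax) : ∃ l ∈ dom lmax, 0 < l := by
  obtain ⟨l, h1, h2⟩ := EReal.lt_iff_exists_real_btwn.1 h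
  exact ⟨l, ⟨by exact_mod_cast h1.le, h2⟩, by exact_mod_cast h1⟩

theorem convex_dom (lmax : EReal) : Convex ℝ (dom lmax) := (ordConnected_dom lmax).convex

theorem uniqueDiffOn_dom {lmax : EReal} (h : 0 < lmax) : UniqueDiffOn ℝ (dom lmax) := by
  obtain ⟨l, hl, hl0⟩ := exists_pos_mem_dom h
  refine uniqueDiffOn_convex (convex_dom _) ⟨l / 2, ?_⟩
  refine mem_interior.2 ⟨Ioo 0 l, fun x hx => dom_of_le hl hx.1.le hx.2.le, isOpen_Ioo, ?_⟩
  constructor <;> linarith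

variable {lmax : EReal} {ψ : ℝ → ℝ}

theorem IsCGFLike.differentiableOn (hψ : IsCGFLike lmax ψ) : DifferentiableOn ℝ ψ (dom lmax) :=
  hψ.contDiffOn.differentiableOn (by norm_num)

/-- Tangent line inequality on `[0, lmax)`. -/
theorem IsCGFLike.tangent_le (hψ : IsCGFLike lmax ψ) {a b : ℝ} (ha : a ∈ dom lmax)
    (hb : b ∈ dom lmax) : ψ a + derivWithin ψ (dom lmax) a * (b - a) ≤ ψ b := by
  have hc := hψ.strictConvexOn.convexOn
  have hd := hψ.differentiableOn a ha
  rcases lt_trichotomy a b with h | h | h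
  · have := hc.derivWithin_le_slope ha hb h hd
    rw [slope_def_field, le_div_iff₀ (by linarith)] at this
    linarith
  · simp [h]
  · have := hc.slope_le_derivWithin hb ha h hd
    rw [slope_def_field, div_le_iff₀ (by linarith)] at this
    linarith

/-- Every slope `u ≥ 0` is attained by `ψ'`. -/
theorem IsCGFLike.exists_deriv_eq (hψ : IsCGFLike lmax ψ) (hs : IsSteep lmax ψ) {u : ℝ}
    (hu : 0 ≤ u) : ∃ l ∈ dom lmax, derivWithin ψ (dom lmax) l = u := by
  have hcont : ContinuousOn (derivWithin ψ (dom lmax)) (dom lmax) :=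
    hψ.contDiffOn.continuousOn_derivWithin (uniqueDiffOn_dom hψ.lmax_pos) (by norm_num)
  obtain ⟨y, ⟨b, hb, rfl⟩, hy⟩ := not_bddAbove_iff.1 hs u
  have himg := (convex_dom lmax).isPreconnected.image _ hcont
  exact himg.ordConnected.out (mem_image_of_mem _ (zero_mem_dom hψ.lmax_pos))
    (mem_image_of_mem _ hb) ⟨by rw [hψ.deriv_zero]; exact hu, hy.le⟩

/-- The supremum defining `ψ*(u)` is attained. -/
theorem IsCGFLike.exists_conj_eq (hψ : IsCGFLike lmax ψ) (hs : IsSteep lmax ψ) {u : ℝ}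
    (hu : 0 ≤ u) : ∃ l ∈ dom lmax, conj lmax ψ u = u * l - ψ l ∧
      ∀ m ∈ dom lmax, u * m - ψ m ≤ conj lmax ψ u := by
  obtain ⟨l, hl, rfl⟩ := hψ.exists_deriv_eq hs hu
  have hg : IsGreatest ((fun m => derivWithin ψ (dom lmax) l * m - ψ m) '' dom lmax)
      (derivWithin ψ (dom lmax) l * l - ψ l) := by
    refine ⟨mem_image_of_mem _ hl, ?_⟩
    rintro _ ⟨m, hm, rfl⟩
    have := hψ.tangent_le hl hm
    simp only
    linarith
  refine ⟨l, hl, hg.csSup_eq, fun m hm => ?_⟩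
  rw [conj, hg.csSup_eq]
  exact hg.2 (mem_image_of_mem _ hm)

theorem IsCGFLike.conj_zero (hψ : IsCGFLike lmax ψ) (hs : IsSteep lmax ψ) :
    conj lmax ψ 0 = 0 := by
  obtain ⟨l, hl, h1, h2⟩ := hψ.exists_conj_eq hs le_rfl
  have := h2 0 (zero_mem_dom hψ.lmax_pos)
  have := hψ.nonneg l hl
  simp only [hψ.zero, zero_mul] at *
  linarith

/-- If the maximizer at `u` is some `l > 0`, the same `l` already gives a larger value at `v`. If it
is `0`, then `ψ*(v) ≤ 0` would force `ψ` above the line of slope `v`, contradicting `ψ' 0 = 0`. -/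
theorem IsCGFLike.conj_strictMonoOn (hψ : IsCGFLike lmax ψ) (hs : IsSteep lmax ψ) :
    StrictMonoOn (conj lmax ψ) (Ici 0) := by
  intro u hu v hv huv
  rw [mem_Ici] at hu hv
  obtain ⟨l, hl, h1, -⟩ := hψ.exists_conj_eq hs hu
  obtain ⟨m, hm, h2, h3⟩ := hψ.exists_conj_eq hs hv
  rcases hl.1.eq_or_lt with h0 | h0
  · subst h0
    rw [h1, h2]
    by_contra! hle
    have hsc : ∀ x ∈ dom lmax, v * x ≤ ψ x := fun x hx => by
      have := h3 x hx
      simp only [hψ.zero] at *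
      linarith
    have hv0 : 0 < v := lt_of_le_of_lt hu huv
    -- Where `ψ'` equals `v / 2`, the tangent evaluated at `0` gives `ψ a ≤ (v / 2) * a`, while `ψ a
    -- ≥ v * a`; hence `a = 0`, where the slope is `0`.
    obtain ⟨a, ha, ha'⟩ := hψ.exists_deriv_eq hs (u := v / 2) (by positivity)
    have h4 := hψ.tangent_le ha (zero_mem_dom hψ.lmax_pos)
    have h5 := hsc a ha
    rw [hψ.zero, ha'] at h4
    have ha0 : a = 0 := by
      by_contra hne
      have : 0 < a := lt_of_le_of_ne ha.1 (Ne.symm hne)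
      nlinarith
    rw [ha0, hψ.deriv_zero] at ha'
    linarith
  · have := h3 l hl
    rw [h1]
    nlinarith

/-- Intermediate value theorem on `[0, U]`, with `U` chosen so that `U * b - ψ b = y`. Continuity
holds because maximizers for slopes in `[0, U]` are bounded. -/
theorem IsCGFLike.conj_surjOn (hψ : IsCGFLike lmax ψ) (hs : IsSteep lmax ψ) :
    SurjOn (conj lmax ψ) (Ici 0) (Ici 0) := by
  intro y hy
  obtain ⟨b, hb, hb0⟩ := exists_pos_mem_dom hψ.lmax_pos
  rw [mem_Ici] at hy
  set U := (y + ψ b) / b with hU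
  have hU0 : 0 ≤ U := div_nonneg (add_nonneg hy (hψ.nonneg b hb)) hb0.le
  have hyU : y ≤ conj lmax ψ U := by
    obtain ⟨-, -, -, h1⟩ := hψ.exists_conj_eq hs hU0
    have h2 := h1 b hb
    rw [hU, div_mul_cancel₀ _ hb0.ne'] at h2
    linarith
  have hU1 : (0 : ℝ) ≤ U + 1 := by linarith
  obtain ⟨-, -, -, hC⟩ := hψ.exists_conj_eq hs hU1
  have hC0 : 0 ≤ conj lmax ψ (U + 1) := by
    simpa [hψ.zero] using hC 0 (zero_mem_dom hψ.lmax_pos)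
  have hlip : LipschitzOnWith (conj lmax ψ (U + 1)).toNNReal (conj lmax ψ) (Icc 0 U) := by
    refine LipschitzOnWith.of_le_add_mul _ fun v hv u hu => ?_
    rw [Real.coe_toNNReal _ hC0, Real.dist_eq]
    obtain ⟨l, hl, h1, h2⟩ := hψ.exists_conj_eq hs hv.1
    obtain ⟨-, -, -, h3⟩ := hψ.exists_conj_eq hs hu.1
    have h4 := h2 0 (zero_mem_dom hψ.lmax_pos)
    have h5 := hC l hl
    have h6 := h3 l hl
    rw [hψ.zero] at h4
    -- Since `v ≤ U` and `v * l - ψ l ≥ 0`, raising the slope to `U + 1` gains at least `l`.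
    have hlC : l ≤ conj lmax ψ (U + 1) := by nlinarith [hl.1, hv.2]
    calc conj lmax ψ v ≤ conj lmax ψ u + l * (v - u) := by rw [h1]; linarith
      _ ≤ conj lmax ψ u + l * |v - u| := by
        gcongr
        · exact hl.1
        · exact le_abs_self _
      _ ≤ _ := by gcongr
  obtain ⟨u, hu, huy⟩ := intermediate_value_Icc hU0 hlip.continuousOn
    (show y ∈ Icc _ _ from ⟨by rw [hψ.conj_zero hs]; exact hy, hyU⟩)
  exact ⟨u, hu.1, huy⟩

theorem IsCGFLike.conjInv_nonneg (hψ : IsCGFLike lmax ψ) (hs : IsSteep lmax ψ) {x : ℝ}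
    (hx : 0 ≤ x) : 0 ≤ conjInv lmax ψ x :=
  Function.invFunOn_mem (hψ.conj_surjOn hs hx)

theorem IsCGFLike.conj_conjInv (hψ : IsCGFLike lmax ψ) (hs : IsSteep lmax ψ) {x : ℝ}
    (hx : 0 ≤ x) : conj lmax ψ (conjInv lmax ψ x) = x :=
  Function.invFunOn_eq (hψ.conj_surjOn hs hx)

theorem IsCGFLike.conjInv_mono (hψ : IsCGFLike lmax ψ) (hs : IsSteep lmax ψ) {x y : ℝ}
    (hx : 0 ≤ x) (hxy : x ≤ y) : conjInv lmax ψ x ≤ conjInv lmax ψ y := by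
  have hy := hx.trans hxy
  rwa [← (hψ.conj_strictMonoOn hs).le_iff_le (hψ.conjInv_nonneg hs hx) (hψ.conjInv_nonneg hs hy),
    hψ.conj_conjInv hs hx, hψ.conj_conjInv hs hy]

/-- For super-Gaussian `ψ`, the conjugate grows at most quadratically. -/
theorem IsCGFLike.conj_mul_le (hψ : IsCGFLike lmax ψ) (hs : IsSteep lmax ψ)
    (hg : IsSuperGaussian lmax ψ) {c u : ℝ} (hc : 1 ≤ c) (hu : 0 ≤ u) :
    conj lmax ψ (c * u) ≤ c ^ 2 * conj lmax ψ u := by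
  have hc0 : 0 < c := by linarith
  obtain ⟨l, hl, h1, -⟩ := hψ.exists_conj_eq hs (mul_nonneg hc0.le hu)
  obtain ⟨-, -, -, h2⟩ := hψ.exists_conj_eq hs hu
  have hlc : l / c ≤ l := div_le_self hl.1 hc
  have hld : l / c ∈ dom lmax := dom_of_le hl (div_nonneg hl.1 hc0.le) hlc
  -- Monotonicity of `ψ(l) / l²` between `l / c` and `l`; the test point `l / c` for `ψ*(u)` then
  -- gives the claim.
  have key : c ^ 2 * ψ (l / c) ≤ ψ l := by
    rcases hl.1.eq_or_lt with h0 | h0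
    · simp [← h0, hψ.zero]
    · have hpos : 0 < l / c := div_pos h0 hc0
      have := hg ⟨hld, by simpa using hpos.ne'⟩ ⟨hl, by simpa using h0.ne'⟩ hlc
      simp only at this
      rw [div_le_div_iff₀ (by positivity) (by positivity), div_pow, mul_div_assoc',
        le_div_iff₀ (by positivity)] at this
      have hl2 : 0 < l ^ 2 := by positivity
      nlinarith
  have h3 := mul_le_mul_of_nonneg_left (h2 _ hld) (sq_nonneg c)
  have e : c ^ 2 * (u * (l / c)) = c * u * l := by field_simp
  rw [h1]
  linarith

/-- The inverse form of `conj_mul_le`: it lets a factor outside `(ψ*)⁻¹` be absorbed, squared, into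
the argument. -/
theorem IsCGFLike.mul_conjInv_le (hψ : IsCGFLike lmax ψ) (hs : IsSteep lmax ψ)
    (hg : IsSuperGaussian lmax ψ) {c x : ℝ} (hc : 1 ≤ c) (hx : 0 ≤ x) :
    c * conjInv lmax ψ x ≤ conjInv lmax ψ (c ^ 2 * x) := by
  have hc0 : 0 ≤ c := by linarith
  have hx' : 0 ≤ c ^ 2 * x := by positivity
  have h0 := hψ.conjInv_nonneg hs hx
  rw [← (hψ.conj_strictMonoOn hs).le_iff_le (mul_nonneg hc0 h0) (hψ.conjInv_nonneg hs hx'),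
    hψ.conj_conjInv hs hx']
  simpa [hψ.conj_conjInv hs hx] using hψ.conj_mul_le hs hg hc h0

/-- A slope `l` for which the line `(x + ψ l * v) / l` touches `v * (ψ*)⁻¹(x / v)`. -/
theorem IsCGFLike.exists_tangent_slope (hψ : IsCGFLike lmax ψ) (hs : IsSteep lmax ψ) {x v : ℝ}
    (hx : 0 < x) (hv : 0 < v) : ∃ l ∈ dom lmax, 0 < l ∧
      x + ψ l * v = l * (v * conjInv lmax ψ (x / v)) := by
  have hxv : 0 < x / v := div_pos hx hv
  -- The slope is a maximizer in `ψ*` at `(ψ*)⁻¹(x / v)`; it is nonzero because the attained value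
  -- `x / v` is positive.
  obtain ⟨l, hl, h1, -⟩ := hψ.exists_conj_eq hs (hψ.conjInv_nonneg hs hxv.le)
  rw [hψ.conj_conjInv hs hxv.le, div_eq_iff hv.ne'] at h1
  refine ⟨l, hl, lt_of_le_of_ne hl.1 ?_, by linarith⟩
  rintro rfl
  simp [hψ.zero] at h1
  exact hx.ne' h1

end OnlineRegression

namespace OnlineRegression

/-! ### Spectral estimates -/

variable {d : ℕ} {V : Matrix (Fin d) (Fin d) ℝ}

theorem continuousOn_real_spectrum (V : Matrix (Fin d) (Fin d) ℝ) (g : ℝ → ℝ) :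
    ContinuousOn g (spectrum ℝ V) :=
  V.finite_real_spectrum.continuousOn g

theorem toEuclideanLin_cfc_eigenvectorBasis (hV : V.IsHermitian) (g : ℝ → ℝ) (n : Fin d) :
    (cfc g V).toEuclideanLin (hV.eigenvectorBasis n)
      = g (hV.eigenvalues n) • hV.eigenvectorBasis n := by
  have h1 : (cfc g V) * hV.eigenvectorUnitary.1
      = hV.eigenvectorUnitary.1 * Matrix.diagonal (g ∘ hV.eigenvalues) := by
    rw [hV.cfc_eq, Matrix.IsHermitian.cfc, Unitary.conjStarAlgAut_apply]
    simp [Matrix.mul_assoc]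
  ext i
  have h2 := congrFun (congrFun h1 i) n
  rw [Matrix.mul_diagonal, Matrix.mul_apply] at h2
  simp only [Matrix.IsHermitian.eigenvectorUnitary_apply, Function.comp] at h2
  rw [Matrix.toLpLin_apply]
  simp only [Matrix.mulVec, dotProduct, PiLp.smul_apply, smul_eq_mul]
  rw [h2, mul_comm]

theorem inner_eigenvectorBasis_cfc (hV : V.IsHermitian) (g : ℝ → ℝ) (n : Fin d)
    (x : EuclideanSpace ℝ (Fin d)) :
    ⟪hV.eigenvectorBasis n, (cfc g V).toEuclideanLin x⟫
      = g (hV.eigenvalues n) * ⟪hV.eigenvectorBasis n, x⟫ := by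
  have hsym : (cfc g V).IsHermitian := cfc_predicate g V
  rw [← Matrix.isSymmetric_toEuclideanLin_iff.2 hsym, toEuclideanLin_cfc_eigenvectorBasis,
    real_inner_smul_left]

/-- In the eigenbasis of `V` every function of `V` is diagonal, so quadratic form comparisons reduce
to scalar inequalities on the spectrum. -/
theorem inner_cfc_self (hV : V.IsHermitian) (g : ℝ → ℝ) (x : EuclideanSpace ℝ (Fin d)) :
    ⟪x, (cfc g V).toEuclideanLin x⟫
      = ∑ n, g (hV.eigenvalues n) * ⟪hV.eigenvectorBasis n, x⟫ ^ 2 := by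
  rw [← hV.eigenvectorBasis.sum_inner_mul_inner]
  refine Finset.sum_congr rfl fun n _ => ?_
  rw [inner_eigenvectorBasis_cfc, real_inner_comm]
  ring

theorem inner_cfc_self_mono (hV : V.IsHermitian) {f g : ℝ → ℝ}
    (h : ∀ y ∈ spectrum ℝ V, f y ≤ g y) (x : EuclideanSpace ℝ (Fin d)) :
    ⟪x, (cfc f V).toEuclideanLin x⟫ ≤ ⟪x, (cfc g V).toEuclideanLin x⟫ := by
  rw [inner_cfc_self hV, inner_cfc_self hV]
  gcongr with n
  exact h _ (hV.eigenvalues_mem_spectrum_real n)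

theorem inner_cfc_const (hV : V.IsHermitian) (c : ℝ) (x : EuclideanSpace ℝ (Fin d)) :
    ⟪x, (cfc (fun _ => c) V).toEuclideanLin x⟫ = c * ‖x‖ ^ 2 := by
  rw [inner_cfc_self hV, ← Finset.mul_sum, ← hV.eigenvectorBasis.sum_sq_norm_inner_right x]
  simp

theorem norm_sq_cfc (hV : V.IsHermitian) (g : ℝ → ℝ) (x : EuclideanSpace ℝ (Fin d)) :
    ‖(cfc g V).toEuclideanLin x‖ ^ 2
      = ⟪x, (cfc (fun y => g y ^ 2) V).toEuclideanLin x⟫ := by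
  rw [inner_cfc_self hV, ← hV.eigenvectorBasis.sum_sq_norm_inner_right]
  refine Finset.sum_congr rfl fun n _ => ?_
  rw [inner_eigenvectorBasis_cfc, Real.norm_eq_abs, sq_abs]
  ring

theorem norm_cfc_le (hV : V.IsHermitian) {g : ℝ → ℝ} {C : ℝ} (hC : 0 ≤ C)
    (h : ∀ y ∈ spectrum ℝ V, |g y| ≤ C) (x : EuclideanSpace ℝ (Fin d)) :
    ‖(cfc g V).toEuclideanLin x‖ ≤ C * ‖x‖ := by
  refine le_of_sq_le_sq ?_ (by positivity)
  rw [norm_sq_cfc hV, mul_pow, ← inner_cfc_const hV]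
  exact inner_cfc_self_mono hV (fun y hy => sq_le_sq' (by linarith [abs_le.1 (h y hy)])
    (abs_le.1 (h y hy)).2) x

theorem isHermitian_vee (V : Matrix (Fin d) (Fin d) ℝ) (ρ : ℝ) : (vee V ρ).IsHermitian :=
  cfc_predicate _ V

theorem gammaMin_le_of_mem_spectrum {y : ℝ} (hy : y ∈ spectrum ℝ V) : gammaMin V ≤ y :=
  csInf_le V.finite_real_spectrum.bddBelow hy

theorem le_gammaMax_of_mem_spectrum {y : ℝ} (hy : y ∈ spectrum ℝ V) : y ≤ gammaMax V :=
  le_csSup V.finite_real_spectrum.bddAbove hy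

theorem le_of_mem_spectrum_vee (hV : V.IsHermitian) {ρ y : ℝ} (hy : y ∈ spectrum ℝ (vee V ρ)) :
    ρ ≤ y := by
  rw [vee, cfc_map_spectrum _ V hV.isSelfAdjoint (continuousOn_real_spectrum V _)] at hy
  obtain ⟨z, -, rfl⟩ := hy
  exact le_max_right _ _

theorem le_gammaMin_vee (hd : 1 ≤ d) (hV : V.IsHermitian) (ρ : ℝ) : ρ ≤ gammaMin (vee V ρ) := by
  obtain ⟨n, hn⟩ := (gammaMin_isLeast hd _ (isHermitian_vee V ρ)).1
  exact le_of_mem_spectrum_vee hV (hn ▸ (isHermitian_vee V ρ).eigenvalues_mem_spectrum_real n)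

theorem gammaMin_le_gammaMax (hd : 1 ≤ d) (hV : V.IsHermitian) : gammaMin V ≤ gammaMax V := by
  obtain ⟨n, hn⟩ := (gammaMin_isLeast hd _ hV).1
  exact le_gammaMax_of_mem_spectrum (hn ▸ hV.eigenvalues_mem_spectrum_real n)

theorem msqrt_vee_eq (hV : V.IsHermitian) (ρ : ℝ) :
    msqrt (vee V ρ) = cfc (fun y => √(max y ρ)) V := by
  rw [msqrt, vee, ← cfc_comp' _ _ V (V.finite_real_spectrum.image _ |>.continuousOn _)
    (continuousOn_real_spectrum V _) hV.isSelfAdjoint]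

theorem msqrt_vee_mul_self (hV : V.IsHermitian) {ρ : ℝ} (hρ : 0 ≤ ρ) :
    msqrt (vee V ρ) * msqrt (vee V ρ) = vee V ρ := by
  rw [msqrt_vee_eq hV, vee, ← cfc_mul _ _ V (continuousOn_real_spectrum V _)
    (continuousOn_real_spectrum V _)]
  exact cfc_congr fun y _ => Real.mul_self_sqrt (hρ.trans (le_max_right _ _))

theorem isHermitian_msqrt (V : Matrix (Fin d) (Fin d) ℝ) : (msqrt V).IsHermitian :=
  cfc_predicate _ V

theorem inner_msqrt_vee (hV : V.IsHermitian) {ρ : ℝ} (hρ : 0 ≤ ρ)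
    (x y : EuclideanSpace ℝ (Fin d)) :
    ⟪(msqrt (vee V ρ)).toEuclideanLin x, (msqrt (vee V ρ)).toEuclideanLin y⟫
      = ⟪x, (vee V ρ).toEuclideanLin y⟫ := by
  rw [Matrix.isSymmetric_toEuclideanLin_iff.2 (isHermitian_msqrt _)]
  conv_rhs => rw [← msqrt_vee_mul_self hV hρ]
  simp [Matrix.toLpLin_apply, Matrix.mulVec_mulVec]

theorem norm_sq_msqrt_vee (hV : V.IsHermitian) {ρ : ℝ} (hρ : 0 ≤ ρ)
    (x : EuclideanSpace ℝ (Fin d)) :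
    ‖(msqrt (vee V ρ)).toEuclideanLin x‖ ^ 2 = ⟪x, (vee V ρ).toEuclideanLin x⟫ := by
  rw [← inner_msqrt_vee hV hρ, real_inner_self_eq_norm_sq]

theorem gammaMin_mul_le_inner (hV : V.IsHermitian) (x : EuclideanSpace ℝ (Fin d)) :
    gammaMin V * ‖x‖ ^ 2 ≤ ⟪x, V.toEuclideanLin x⟫ := by
  rw [← inner_cfc_const hV]
  conv_rhs => rw [← cfc_id' ℝ V hV.isSelfAdjoint]
  exact inner_cfc_self_mono hV (fun y hy => gammaMin_le_of_mem_spectrum hy) x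

theorem inner_le_gammaMax_mul (hV : V.IsHermitian) (x : EuclideanSpace ℝ (Fin d)) :
    ⟪x, V.toEuclideanLin x⟫ ≤ gammaMax V * ‖x‖ ^ 2 := by
  rw [← inner_cfc_const hV]
  conv_lhs => rw [← cfc_id' ℝ V hV.isSelfAdjoint]
  exact inner_cfc_self_mono hV (fun y hy => le_gammaMax_of_mem_spectrum hy) x

theorem inner_le_inner_vee (hV : V.IsHermitian) (ρ : ℝ) (x : EuclideanSpace ℝ (Fin d)) :
    ⟪x, V.toEuclideanLin x⟫ ≤ ⟪x, (vee V ρ).toEuclideanLin x⟫ := by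
  conv_lhs => rw [← cfc_id' ℝ V hV.isSelfAdjoint]
  exact inner_cfc_self_mono hV (fun y hy => le_max_left _ _) x

theorem isUnit_det_vee (hV : V.IsHermitian) {ρ : ℝ} (hρ : 0 < ρ) : IsUnit (vee V ρ).det := by
  refine Matrix.isUnit_det_of_right_inverse (B := cfc (fun y => (max y ρ)⁻¹) V) ?_
  rw [vee, ← cfc_mul _ _ V (continuousOn_real_spectrum V _) (continuousOn_real_spectrum V _),
    ← cfc_const_one ℝ V]
  exact cfc_congr fun y _ => mul_inv_cancel₀ (hρ.trans_le (le_max_right _ _)).ne'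

/-- Writing the bias operator as a function of `V` reduces its norm bound to a scalar estimate. -/
theorem vee_inv_mul_vee_sub (hV : V.IsHermitian) {ρ : ℝ} (hρ : 0 < ρ) :
    (vee V ρ)⁻¹ * (vee V ρ - V) = cfc (fun y => (max y ρ - y) / max y ρ) V := by
  have : vee V ρ * cfc (fun y => (max y ρ - y) / max y ρ) V = vee V ρ - V := by
    rw [vee, ← cfc_mul _ _ V (continuousOn_real_spectrum V _) (continuousOn_real_spectrum V _)]
    conv_rhs => enter [2]; rw [← cfc_id' ℝ V hV.isSelfAdjoint]
    rw [← cfc_sub _ _ V (continuousOn_real_spectrum V _) (continuousOn_real_spectrum V _)]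
    refine cfc_congr fun y _ => ?_
    have : max y ρ ≠ 0 := (hρ.trans_le (le_max_right _ _)).ne'
    field_simp
  rw [← this, Matrix.nonsing_inv_mul_cancel_left _ _ (isUnit_det_vee hV hρ)]

/-- The bias caused by the shrinkage. -/
theorem norm_shrinkage_bias_le (hV : V.PosSemidef) {ρ : ℝ} (hρ : 0 < ρ)
    (x : EuclideanSpace ℝ (Fin d)) :
    ‖(msqrt (vee V ρ)).toEuclideanLin
        (((vee V ρ)⁻¹ * (vee V ρ - V)).toEuclideanLin x)‖
      ≤ √ρ * ‖x‖ * (if gammaMin V < ρ then 1 else 0) := by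
  have hH := hV.isHermitian
  have e : (msqrt (vee V ρ)).toEuclideanLin (((vee V ρ)⁻¹ * (vee V ρ - V)).toEuclideanLin x)
      = (cfc (fun y => √(max y ρ) * ((max y ρ - y) / max y ρ)) V).toEuclideanLin x := by
    rw [cfc_mul _ _ V (continuousOn_real_spectrum V _) (continuousOn_real_spectrum V _),
      vee_inv_mul_vee_sub hH hρ, msqrt_vee_eq hH]
    simp [Matrix.toLpLin_apply, Matrix.mulVec_mulVec]
  rw [e]
  have hnn : ∀ y ∈ spectrum ℝ V, 0 ≤ y := by
    intro y hy
    rw [hH.spectrum_real_eq_range_eigenvalues] at hy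
    obtain ⟨n, rfl⟩ := hy
    exact hV.eigenvalues_nonneg n
  split_ifs with hlt
  · rw [mul_one]
    refine norm_cfc_le hH (Real.sqrt_nonneg _) (fun y hy => ?_) x
    have hy0 := hnn y hy
    rcases le_total ρ y with h | h
    · simp [max_eq_left h]
    · rw [max_eq_right h, abs_of_nonneg (mul_nonneg (Real.sqrt_nonneg _)
        (div_nonneg (by linarith) hρ.le))]
      refine mul_le_of_le_one_right (Real.sqrt_nonneg _) ?_
      rw [div_le_one hρ]
      linarith
  · rw [mul_zero, ← zero_mul ‖x‖]
    refine norm_cfc_le hH le_rfl (fun y hy => ?_) x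
    have : ρ ≤ y := (not_lt.1 hlt).trans (gammaMin_le_of_mem_spectrum hy)
    simp [max_eq_left this]

/-- A nearby direction captures a `1 - ε` fraction of the norm of a vector in the geometry of a
well conditioned linear map. -/
theorem exists_cover_inner_ge {E F : Type*} [NormedAddCommGroup E] [InnerProductSpace ℝ E]
    [NormedAddCommGroup F] [InnerProductSpace ℝ F] (A : E →ₗ[ℝ] F) {γ Γ r ε : ℝ}
    (hγ : ∀ x, γ * ‖x‖ ^ 2 ≤ ‖A x‖ ^ 2) (hΓ : ∀ x, ‖A x‖ ^ 2 ≤ Γ * ‖x‖ ^ 2)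
    (hΓ0 : 0 ≤ Γ) (hrε : r ^ 2 * Γ ≤ ε ^ 2 * γ) (hε0 : 0 ≤ ε) (hε1 : ε ≤ 1)
    {K : Set E} (hK : ∀ x : E, ‖x‖ = 1 → ∃ ν ∈ K, ‖x - ν‖ ≤ r) (hK0 : K.Nonempty) (u : E) :
    ∃ ν ∈ K, (1 - ε) * ‖A ν‖ * ‖A u‖ ≤ ⟪A ν, A u⟫ := by
  by_cases hu : u = 0
  · obtain ⟨ν, hν⟩ := hK0
    exact ⟨ν, hν, by simp [hu]⟩
  have hu0 : 0 < ‖u‖ := norm_pos_iff.2 hu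
  set x : E := ‖u‖⁻¹ • u with hx
  have hx1 : ‖x‖ = 1 := by rw [hx, norm_smul, norm_inv, norm_norm, inv_mul_cancel₀ hu0.ne']
  have hux : u = ‖u‖ • x := by rw [hx, smul_smul, mul_inv_cancel₀ hu0.ne', one_smul]
  obtain ⟨ν, hν, hd⟩ := hK x hx1
  refine ⟨ν, hν, ?_⟩
  have h1 : ‖A x - A ν‖ ^ 2 ≤ ε ^ 2 * ‖A x‖ ^ 2 := by
    calc ‖A x - A ν‖ ^ 2 = ‖A (x - ν)‖ ^ 2 := by rw [map_sub]
      _ ≤ Γ * ‖x - ν‖ ^ 2 := hΓ _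
      _ ≤ Γ * r ^ 2 := by gcongr
      _ ≤ ε ^ 2 * γ := by linarith
      _ ≤ ε ^ 2 * ‖A x‖ ^ 2 := by
        have := hγ x
        rw [hx1, one_pow, mul_one] at this
        gcongr
  have h2 : (1 - ε) * ‖A ν‖ * ‖A x‖ ≤ ⟪A ν, A x⟫ := by
    -- Expanding `h1` gives `2⟪A ν, A x⟫ ≥ ‖A ν‖² + (1 - ε²)‖A x‖²`. Now split `1 - ε² = (1 - ε)² +
    -- 2ε(1 - ε)` and complete the square.
    rw [norm_sub_sq_real, real_inner_comm] at h1
    nlinarith [sq_nonneg (‖A ν‖ - (1 - ε) * ‖A x‖),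
      mul_nonneg (mul_nonneg hε0 (sub_nonneg.2 hε1)) (sq_nonneg ‖A x‖)]
  rw [hux, map_smul, norm_smul, norm_norm, real_inner_smul_right]
  have := mul_le_mul_of_nonneg_left h2 hu0.le
  linarith

end OnlineRegression

namespace OnlineRegression

/-! ### Covers of the sphere -/

/-- Compactness of the sphere. Finiteness matters because `toNat` in `sphereCov` sends `⊤` to `0`.
-/
theorem coveringNumber_sphere_ne_top (d : ℕ) {r : ℝ} (hr : 0 < r) :
    Metric.coveringNumber r.toNNReal (Metric.sphere (0 : EuclideanSpace ℝ (Fin d)) 1) ≠ ⊤ := by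
  obtain ⟨N, hN, hfin, hcov⟩ := Metric.exists_finite_isCover_of_isCompact
    (Real.toNNReal_pos.2 hr).ne' (isCompact_sphere (0 : EuclideanSpace ℝ (Fin d)) 1)
  exact ne_top_of_le_ne_top (Set.encard_ne_top_iff.2 hfin) (hcov.coveringNumber_le_encard hN)

theorem sphereCov_anti (d : ℕ) {r s : ℝ} (hr : 0 < r) (hrs : r ≤ s) :
    sphereCov d s ≤ sphereCov d r :=
  ENat.toNat_le_toNat (Metric.coveringNumber_anti (Real.toNNReal_le_toNNReal hrs))
    (coveringNumber_sphere_ne_top d hr)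

theorem one_le_sphereCov {d : ℕ} (hd : 1 ≤ d) {r : ℝ} (hr : 0 < r) : 1 ≤ sphereCov d r := by
  have : Nonempty (Fin d) := ⟨⟨0, hd⟩⟩
  have hne : (Metric.sphere (0 : EuclideanSpace ℝ (Fin d)) 1).Nonempty :=
    NormedSpace.sphere_nonempty.2 zero_le_one
  rw [Nat.one_le_iff_ne_zero, sphereCov, Ne, ENat.toNat_eq_zero, not_or]
  exact ⟨(Metric.coveringNumber_pos_iff.2 hne).ne', coveringNumber_sphere_ne_top d hr⟩

theorem exists_finset_sphere_cover (d : ℕ) {r : ℝ} (hr : 0 < r) :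
    ∃ K : Finset (EuclideanSpace ℝ (Fin d)), K.card = sphereCov d r ∧ (∀ ν ∈ K, ‖ν‖ = 1) ∧
      ∀ x : EuclideanSpace ℝ (Fin d), ‖x‖ = 1 → ∃ ν ∈ K, ‖x - ν‖ ≤ r := by
  have hne := coveringNumber_sphere_ne_top d hr
  set A := Metric.sphere (0 : EuclideanSpace ℝ (Fin d)) 1 with hA
  have hfin : (Metric.minimalCover r.toNNReal A).Finite := Metric.finite_minimalCover
  refine ⟨hfin.toFinset, ?_, fun ν hν => ?_, fun x hx => ?_⟩
  · rw [sphereCov, ← Metric.encard_minimalCover hne, hfin.encard_eq_coe_toFinset_card]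
    rfl
  · have := Metric.minimalCover_subset (hfin.mem_toFinset.1 hν)
    simpa [hA] using this
  · obtain ⟨ν, hν, hd⟩ := Metric.isCover_minimalCover hne (x := x) (by simpa [hA] using hx)
    refine ⟨ν, hfin.mem_toFinset.2 hν, ?_⟩
    have hd' : edist x ν ≤ (r.toNNReal : ℝ≥0∞) := hd
    rw [edist_nndist, ENNReal.coe_le_coe, ← NNReal.coe_le_coe, coe_nndist,
      Real.coe_toNNReal _ hr.le, dist_eq_norm] at hd'
    exact hd'

/-! ### Stitching -/

variable {lmax : EReal} {ψ : ℝ → ℝ}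

/-- A line crossing bound at scale `v'` implies the self-normalized bound at every
`v ∈ [v' / α, v']`. -/
theorem IsCGFLike.lt_sqrt_mul_of_line (hψ : IsCGFLike lmax ψ) (hs : IsSteep lmax ψ)
    (hg : IsSuperGaussian lmax ψ) {α γ v v' w s x B l : ℝ} (hγ : 0 < γ) (hγv : γ ≤ v)
    (hvv' : v ≤ v') (hv'v : v' ≤ α * v) (hwv : w ≤ v) (hx : 0 < x) (hxB : x ≤ B)
    (hl : l ∈ dom lmax) (hl0 : 0 < l)
    (htan : x + ψ l * v' = l * (v' * conjInv lmax ψ (x / v'))) (hline : l * s - ψ l * w < x) :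
    s < √v * (√γ * conjInv lmax ψ (α / γ * B)) := by
  have hv : 0 < v := hγ.trans_le hγv
  have hv' : 0 < v' := hv.trans_le hvv'
  -- Since `w ≤ v'` and `ψ l ≥ 0`, the variance `w` in the line may be raised to `v'`, where the
  -- line is tangent.
  have h1 : s < v' * conjInv lmax ψ (x / v') := by
    have := mul_le_mul_of_nonneg_left (hwv.trans hvv') (hψ.nonneg l hl)
    exact lt_of_mul_lt_mul_left (by linarith) hl0.le
  have hsv : 0 < √v := Real.sqrt_pos.2 hv
  have hsγ : 0 < √γ := Real.sqrt_pos.2 hγ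
  -- The factor that turns the prefactor `v'` into `√v * √γ`. It is at least `1` as `γ ≤ v ≤ v'`,
  -- and `c² / v' = (v' / v) / γ ≤ α / γ`.
  set c := v' / (√v * √γ) with hc
  have hc1 : 1 ≤ c := by
    rw [hc, one_le_div (by positivity), ← Real.sqrt_mul hv.le]
    refine (Real.sqrt_le_left hv'.le).2 ?_
    nlinarith
  have hc2 : c ^ 2 * (x / v') ≤ α / γ * B := by
    have e : c ^ 2 * (x / v') = v' / v * (x / γ) := by
      rw [hc, div_pow, mul_pow, Real.sq_sqrt hv.le, Real.sq_sqrt hγ.le]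
      field_simp
    have hα : v' / v ≤ α := by rwa [div_le_iff₀ hv]
    calc c ^ 2 * (x / v') = v' / v * (x / γ) := e
      _ ≤ α * (B / γ) := by
        gcongr
        exact (div_pos hv' hv).le.trans hα
      _ = α / γ * B := by ring
  have h2 := (hψ.mul_conjInv_le hs hg hc1 (div_pos hx hv').le).trans
    (hψ.conjInv_mono hs (by positivity) hc2)
  calc s < v' * conjInv lmax ψ (x / v') := h1
    _ = √v * (√γ * (c * conjInv lmax ψ (x / v'))) := by rw [hc]; field_simp
    _ ≤ _ := by gcongr

/-- The logarithm of the inverse of the probability allotted to the direction and scale indices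
`j` and `k`. -/
noncomputable def level (d : ℕ) (β ε δ : ℝ) (h : ℝ → ℝ) (j k : ℕ) : ℝ :=
  Real.log (h k) + Real.log (1 / δ * (1 / (1 - β⁻¹)))
    + Real.log (β ^ j * sphereCov d (ε / β ^ (j + 1)))

section level

variable {d : ℕ} {β ε δ : ℝ} {h : ℝ → ℝ}

theorem one_le_inv_one_sub_inv (hβ : 1 < β) : 1 ≤ 1 / (1 - β⁻¹) := by
  have h1 : β⁻¹ < 1 := inv_lt_one_of_one_lt₀ hβ
  have h2 : 0 < β⁻¹ := inv_pos.2 (by linarith)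
  rw [le_div_iff₀ (by linarith)]
  linarith

theorem one_lt_confidence (hβ : 1 < β) (hδ : δ ∈ Ioo (0 : ℝ) 1) :
    1 < 1 / δ * (1 / (1 - β⁻¹)) :=
  one_lt_mul_of_lt_of_le (one_lt_one_div hδ.1 hδ.2) (one_le_inv_one_sub_inv hβ)

theorem one_le_of_tsum_inv_le (h_pos : ∀ k : ℕ, 0 < h k)
    (h_summable : Summable fun k : ℕ => (h k)⁻¹) (h_sum : ∑' k : ℕ, (h k)⁻¹ ≤ 1) (k : ℕ) :
    1 ≤ h k := by
  have := (h_summable.le_tsum k fun i _ => (inv_pos.2 (h_pos i)).le).trans h_sum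
  exact (inv_le_one₀ (h_pos k)).1 this

theorem one_le_pow_mul_sphereCov (hd : 1 ≤ d) (hβ : 1 < β) (hε : 0 < ε) (j : ℕ) :
    1 ≤ β ^ j * (sphereCov d (ε / β ^ (j + 1)) : ℝ) := by
  have : 1 ≤ sphereCov d (ε / β ^ (j + 1)) := one_le_sphereCov hd (by positivity)
  exact one_le_mul_of_one_le_of_one_le (one_le_pow₀ hβ.le) (by exact_mod_cast this)

/-- Strict positivity, needed to choose a tangent slope, comes from `δ < 1`. -/
theorem level_pos (hd : 1 ≤ d) (hβ : 1 < β) (hε : 0 < ε) (hδ : δ ∈ Ioo (0 : ℝ) 1) {k : ℕ}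
    (hk : 1 ≤ h k) (j : ℕ) : 0 < level d β ε δ h j k :=
  add_pos_of_pos_of_nonneg
    (add_pos_of_nonneg_of_pos (Real.log_nonneg hk) (Real.log_pos (one_lt_confidence hβ hδ)))
    (Real.log_nonneg (one_le_pow_mul_sphereCov hd hβ hε j))

/-- The cover size inside the level pays for the union over directions; what remains is a product of
summable weights in `j` and `k`. -/
theorem sphereCov_mul_exp_neg_level (hd : 1 ≤ d) (hβ : 1 < β) (hε : 0 < ε)
    (hδ : δ ∈ Ioo (0 : ℝ) 1) {k : ℕ} (hk : 0 < h k) (j : ℕ) :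
    (sphereCov d (ε / β ^ (j + 1)) : ℝ) * Real.exp (-level d β ε δ h j k)
      = δ * ((1 - β⁻¹) * (β⁻¹) ^ j) * (h k)⁻¹ := by
  have h1 := one_le_sphereCov hd (r := ε / β ^ (j + 1)) (by positivity)
  have h2 : (0 : ℝ) < sphereCov d (ε / β ^ (j + 1)) := by exact_mod_cast h1
  have h3 : 0 < 1 - β⁻¹ := sub_pos.2 (inv_lt_one_of_one_lt₀ hβ)
  have h4 : 0 < δ := hδ.1
  have h5 : 0 < β := by linarith
  rw [Real.exp_neg, level, Real.exp_add, Real.exp_add, Real.exp_log hk,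
    Real.exp_log (by positivity), Real.exp_log (by positivity), inv_pow]
  field_simp

theorem tsum_sphereCov_mul_exp_neg_level_le (hd : 1 ≤ d) (hβ : 1 < β) (hε : 0 < ε)
    (hδ : δ ∈ Ioo (0 : ℝ) 1) (h_pos : ∀ k : ℕ, 0 < h k)
    (h_summable : Summable fun k : ℕ => (h k)⁻¹) (h_sum : ∑' k : ℕ, (h k)⁻¹ ≤ 1) :
    ∑' j : ℕ, ∑' k : ℕ, (sphereCov d (ε / β ^ (j + 1)) : ℝ≥0∞) *
      ENNReal.ofReal (Real.exp (-level d β ε δ h j k)) ≤ ENNReal.ofReal δ := by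
  have hb0 : 0 ≤ β⁻¹ := inv_nonneg.2 (by linarith)
  have hb1 : β⁻¹ < 1 := inv_lt_one_of_one_lt₀ hβ
  have h3 : 0 < 1 - β⁻¹ := sub_pos.2 hb1
  have hterm : ∀ j k : ℕ, (sphereCov d (ε / β ^ (j + 1)) : ℝ≥0∞) *
      ENNReal.ofReal (Real.exp (-level d β ε δ h j k))
        = ENNReal.ofReal δ * ENNReal.ofReal ((1 - β⁻¹) * (β⁻¹) ^ j) *
          ENNReal.ofReal (h k)⁻¹ := by
    intro j k
    rw [← ENNReal.ofReal_natCast, ← ENNReal.ofReal_mul (by positivity),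
      sphereCov_mul_exp_neg_level hd hβ hε hδ (h_pos k), ENNReal.ofReal_mul, ENNReal.ofReal_mul]
    · exact hδ.1.le
    · exact mul_nonneg hδ.1.le (by positivity)
  have hk : ∑' k : ℕ, ENNReal.ofReal (h k)⁻¹ ≤ 1 := by
    rw [← ENNReal.ofReal_tsum_of_nonneg (fun k => (inv_pos.2 (h_pos k)).le) h_summable]
    simpa using h_sum
  have hj : ∑' j : ℕ, ENNReal.ofReal ((1 - β⁻¹) * (β⁻¹) ^ j) = 1 := by
    rw [← ENNReal.ofReal_tsum_of_nonneg (fun j => by positivity)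
      ((summable_geometric_of_lt_one hb0 hb1).mul_left _), tsum_mul_left,
      tsum_geometric_of_lt_one hb0 hb1, mul_inv_cancel₀ h3.ne', ENNReal.ofReal_one]
  simp_rw [hterm, ENNReal.tsum_mul_left]
  rw [ENNReal.tsum_mul_right, ENNReal.tsum_mul_left, hj, mul_one]
  exact mul_le_of_le_one_right zero_le hk

/-- The levels at the scales of a matrix are bounded by `L_ρ`. -/
theorem level_le_Lfun {α ρ : ℝ} {V : Matrix (Fin d) (Fin d) ℝ} (hd : 1 ≤ d) (hα : 1 < α)
    (hβ : 1 < β) (hε : 0 < ε) (hmono : MonotoneOn h (Ici 0)) {j k : ℕ}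
    (hk0 : 0 < h k) (hk : α ^ k ≤ gammaMax (vee V ρ) / ρ)
    (hj : β ^ j ≤ √(kappa (vee V ρ))) :
    level d β ε δ h j k ≤ Lfun α β ρ ε δ h V := by
  have hβ0 : 0 < β := by linarith
  have hκ : 0 < √(kappa (vee V ρ)) := (pow_pos hβ0 j).trans_le hj
  have hklog : (k : ℝ) ≤ Real.logb α (gammaMax (vee V ρ) / ρ) := by
    rw [Real.le_logb_iff_rpow_le hα ((pow_pos (by linarith) k).trans_le hk), Real.rpow_natCast]
    exact hk
  have hk0' : (0 : ℝ) ≤ k := k.cast_nonneg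
  have hpos := one_le_pow_mul_sphereCov hd hβ hε j
  have hβj : β ^ (j + 1) ≤ β * √(kappa (vee V ρ)) := by rw [pow_succ']; gcongr
  have hN : sphereCov d (ε / β ^ (j + 1)) ≤ sphereCov d (ε / (β * √(kappa (vee V ρ)))) :=
    sphereCov_anti d (by positivity) (by gcongr)
  have hβj' : β ^ j ≤ β * √(kappa (vee V ρ)) :=
    hj.trans (le_mul_of_one_le_left hκ.le hβ.le)
  unfold level Lfun
  gcongr
  exact hmono hk0' (hk0'.trans hklog) hklog

end level

/-! ### The self-normalized bound for vector valued processes -/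

theorem toEuclideanLin_inv_vee {d : ℕ} {V : Matrix (Fin d) (Fin d) ℝ} (hV : V.IsHermitian)
    {ρ : ℝ} (hρ : 0 < ρ) (x : EuclideanSpace ℝ (Fin d)) :
    (vee V ρ).toEuclideanLin ((vee V ρ)⁻¹.toEuclideanLin x) = x := by
  simp [Matrix.toLpLin_apply, Matrix.mulVec_mulVec,
    Matrix.mul_nonsing_inv _ (isUnit_det_vee hV hρ)]

theorem inner_toEuclideanLin_eq {d : ℕ} (V : Matrix (Fin d) (Fin d) ℝ)
    (x : EuclideanSpace ℝ (Fin d)) :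
    ⟪x, V.toEuclideanLin x⟫ = x.ofLp ⬝ᵥ (V *ᵥ x.ofLp) := by
  simp [Matrix.toLpLin_apply, EuclideanSpace.inner_eq_star_dotProduct, dotProduct_comm]

/-- The self-normalized bound at a fixed time, given the line crossing bounds. -/
theorem norm_lt_boundary_of_lines (hψ : IsCGFLike lmax ψ) (hψ_super : IsSuperGaussian lmax ψ)
    (hψ_steep : IsSteep lmax ψ) {d : ℕ} (hd : 1 ≤ d) {α β ρ ε δ : ℝ} (hα : 1 < α) (hβ : 1 < β)
    (hρ : 0 < ρ) (hε : ε ∈ Ioo (0 : ℝ) 1) (hδ : δ ∈ Ioo (0 : ℝ) 1) {h : ℝ → ℝ}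
    (h_mono : MonotoneOn h (Ici 0)) (h_one : ∀ k : ℕ, 1 ≤ h k)
    {K : ℕ → Finset (EuclideanSpace ℝ (Fin d))}
    (hK1 : ∀ j, ∀ ν ∈ K j, ‖ν‖ = 1)
    (hK : ∀ j, ∀ x : EuclideanSpace ℝ (Fin d), ‖x‖ = 1 → ∃ ν ∈ K j, ‖x - ν‖ ≤ ε / β ^ (j + 1))
    {l : ℕ → ℕ → ℝ} (hl : ∀ j k, l j k ∈ dom lmax) (hl0 : ∀ j k, 0 < l j k)
    (htan : ∀ j k, level d β ε δ h j k + ψ (l j k) * (ρ * α ^ (k + 1))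
      = l j k * (ρ * α ^ (k + 1) *
        conjInv lmax ψ (level d β ε δ h j k / (ρ * α ^ (k + 1)))))
    {S : EuclideanSpace ℝ (Fin d)} {V : Matrix (Fin d) (Fin d) ℝ} (hV : V.IsHermitian)
    (hline : ∀ j k, ∀ ν ∈ K j, l j k * ⟪ν, S⟫ - ψ (l j k) * (ν.ofLp ⬝ᵥ (V *ᵥ ν.ofLp))
      < level d β ε δ h j k) :
    ‖(msqrt (vee V ρ)).toEuclideanLin ((vee V ρ)⁻¹.toEuclideanLin S)‖
      < boundary lmax ψ α β ρ ε δ h V := by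
  have hHv := isHermitian_vee V ρ
  set A := (msqrt (vee V ρ)).toEuclideanLin with hA
  set u := (vee V ρ)⁻¹.toEuclideanLin S with hu
  set γ := gammaMin (vee V ρ) with hγ_def
  set Γ := gammaMax (vee V ρ) with hΓ_def
  have hγ : 0 < γ := hρ.trans_le (le_gammaMin_vee hd hV ρ)
  have hγΓ : γ ≤ Γ := gammaMin_le_gammaMax hd hHv
  have hκ1 : 1 ≤ √(kappa (vee V ρ)) :=
    Real.one_le_sqrt.2 ((one_le_div hγ).2 hγΓ)
  -- `β^j ≤ √κ < β^(j+1)`: the upper bound makes the radius `ε / β^(j+1)` fine enough, the lower one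
  -- bounds the level by `L_ρ`.
  obtain ⟨j, hj, hj'⟩ := exists_nat_pow_near hκ1 hβ
  have hAlow : ∀ x, γ * ‖x‖ ^ 2 ≤ ‖A x‖ ^ 2 := fun x => by
    rw [hA, norm_sq_msqrt_vee hV hρ.le]; exact gammaMin_mul_le_inner hHv x
  have hAup : ∀ x, ‖A x‖ ^ 2 ≤ Γ * ‖x‖ ^ 2 := fun x => by
    rw [hA, norm_sq_msqrt_vee hV hρ.le]; exact inner_le_gammaMax_mul hHv x
  have hβj : 0 < β ^ (j + 1) := pow_pos (by linarith) _
  have hrε : (ε / β ^ (j + 1)) ^ 2 * Γ ≤ ε ^ 2 * γ := by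
    have h1 : Γ / γ ≤ (β ^ (j + 1)) ^ 2 := ((Real.sqrt_lt' hβj).1 hj').le
    rw [div_le_iff₀ hγ] at h1
    rw [div_pow, div_mul_eq_mul_div, div_le_iff₀ (by positivity)]
    nlinarith [sq_nonneg ε]
  have hKne : (K j : Set (EuclideanSpace ℝ (Fin d))).Nonempty := by
    have : Nonempty (Fin d) := ⟨⟨0, hd⟩⟩
    obtain ⟨x, hx⟩ := NormedSpace.sphere_nonempty (x := (0 : EuclideanSpace ℝ (Fin d)))
      (r := 1) |>.2 zero_le_one
    obtain ⟨ν, hν, -⟩ := hK j x (by simpa using hx)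
    exact ⟨ν, hν⟩
  obtain ⟨ν, hν, hcov⟩ := exists_cover_inner_ge A hAlow hAup (hγ.le.trans hγΓ) hrε hε.1.le hε.2.le
    (hK j) hKne u
  have hν1 := hK1 j ν hν
  have hAu : ⟪A ν, A u⟫ = ⟪ν, S⟫ := by
    rw [hA, inner_msqrt_vee hV hρ.le, hu, toEuclideanLin_inv_vee hV hρ]
  set v := ⟪ν, (vee V ρ).toEuclideanLin ν⟫ with hv_def
  have hvA : ‖A ν‖ = √v := by
    rw [hv_def, ← norm_sq_msqrt_vee hV hρ.le, Real.sqrt_sq (norm_nonneg _)]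
  have hγv : γ ≤ v := by simpa [hν1] using gammaMin_mul_le_inner hHv ν
  have hvΓ : v ≤ Γ := by simpa [hν1] using inner_le_gammaMax_mul hHv ν
  have hρv : ρ ≤ v := (le_gammaMin_vee hd hV ρ).trans hγv
  -- The scale is read off the regularized variance `v ≥ ρ`, so `k ≥ 0` suffices; the line itself
  -- involves the smaller `⟪ν, V ν⟫`.
  obtain ⟨k, hk, hk'⟩ := exists_nat_pow_near ((one_le_div hρ).2 hρv) hα
  have hlev : level d β ε δ h j k ≤ Lfun α β ρ ε δ h V :=
    level_le_Lfun hd hα hβ hε.1 h_mono (zero_lt_one.trans_le (h_one k))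
      (hk.trans (by gcongr)) hj
  have hs : ⟪ν, S⟫ < √v * (√γ * conjInv lmax ψ (α / γ * Lfun α β ρ ε δ h V)) := by
    refine hψ.lt_sqrt_mul_of_line hψ_steep hψ_super (v' := ρ * α ^ (k + 1)) hγ hγv ?_ ?_ ?_
      (level_pos hd hβ hε.1 hδ (h_one k) j) hlev (hl j k) (hl0 j k) (htan j k) (hline j k ν hν)
    · rw [div_lt_iff₀ hρ] at hk'
      linarith
    · rw [le_div_iff₀ hρ] at hk
      rw [pow_succ]
      nlinarith
    · rw [← inner_toEuclideanLin_eq]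
      exact inner_le_inner_vee hV ρ ν
  rw [hAu, hvA] at hcov
  have hsv : 0 < √v := Real.sqrt_pos.2 (hγ.trans_le hγv)
  have h1ε : 0 < 1 - ε := sub_pos.2 hε.2
  rw [boundary, div_mul_eq_mul_div, lt_div_iff₀ h1ε]
  -- The direction-dependent factor `√v = ‖A ν‖` occurs on both sides and cancels.
  refine lt_of_mul_lt_mul_left ?_ hsv.le
  linarith

/-- **Time-uniform self-normalized concentration** for vector valued sub-`ψ` processes. -/
theorem IsSubPsiVec.measure_compl_norm_lt_boundary_le {Ω : Type*} {mΩ : MeasurableSpace Ω}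
    {P : Measure Ω} [IsProbabilityMeasure P] {ℱ : Filtration ℕ mΩ} (hψ : IsCGFLike lmax ψ)
    (hψ_super : IsSuperGaussian lmax ψ) (hψ_steep : IsSteep lmax ψ) {d : ℕ} (hd : 1 ≤ d)
    {S : ℕ → Ω → EuclideanSpace ℝ (Fin d)} {V : ℕ → Ω → Matrix (Fin d) (Fin d) ℝ}
    (hS : IsSubPsiVec P ℱ lmax ψ S V) {α β ρ ε δ : ℝ} (hα : 1 < α) (hβ : 1 < β)
    (hρ : 0 < ρ) (hε : ε ∈ Ioo (0 : ℝ) 1) (hδ : δ ∈ Ioo (0 : ℝ) 1) {h : ℝ → ℝ}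
    (h_mono : MonotoneOn h (Ici 0)) (h_pos : ∀ k : ℕ, 0 < h k)
    (h_summable : Summable fun k : ℕ => (h k)⁻¹) (h_sum : ∑' k : ℕ, (h k)⁻¹ ≤ 1) :
    P {ω | ∀ t, ‖(msqrt (vee (V t ω) ρ)).toEuclideanLin
        ((vee (V t ω) ρ)⁻¹.toEuclideanLin (S t ω))‖ < boundary lmax ψ α β ρ ε δ h (V t ω)}ᶜ
      ≤ ENNReal.ofReal δ := by
  have h_one := one_le_of_tsum_inv_le h_pos h_summable h_sum
  -- Covers and slopes are fixed for all `j`, `k` independently of `ω`; only the pair consulted at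
  -- time `t` is random.
  choose K hKcard hK1 hK using fun j : ℕ => exists_finset_sphere_cover d
    (show 0 < ε / β ^ (j + 1) from div_pos hε.1 (pow_pos (by linarith) _))
  choose l hl hl0 htan using fun j k : ℕ => hψ.exists_tangent_slope hψ_steep
    (level_pos hd hβ hε.1 hδ (h_one k) j) (show 0 < ρ * α ^ (k + 1) by positivity)
  have hsub : {ω | ∀ t, ‖(msqrt (vee (V t ω) ρ)).toEuclideanLin
        ((vee (V t ω) ρ)⁻¹.toEuclideanLin (S t ω))‖ < boundary lmax ψ α β ρ ε δ h (V t ω)}ᶜ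
      ⊆ ⋃ j, ⋃ k, ⋃ ν ∈ K j, {ω | ∃ t, level d β ε δ h j k ≤
        l j k * ⟪ν, S t ω⟫ - ψ (l j k) * (ν.ofLp ⬝ᵥ (V t ω *ᵥ ν.ofLp))} := by
    rw [compl_subset_comm]
    intro ω hω t
    refine norm_lt_boundary_of_lines hψ hψ_super hψ_steep hd hα hβ hρ hε hδ h_mono h_one hK1 hK
      hl hl0 htan (hS.posSemidef_V t ω).isHermitian fun j k ν hν => ?_
    by_contra! hcon
    exact hω (mem_iUnion.2 ⟨j, mem_iUnion.2 ⟨k, mem_biUnion hν ⟨t, hcon⟩⟩⟩)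
  refine (measure_mono hsub).trans (le_trans ?_
    (tsum_sphereCov_mul_exp_neg_level_le hd hβ hε.1 hδ h_pos h_summable h_sum))
  refine (measure_iUnion_le _).trans (ENNReal.tsum_le_tsum fun j => ?_)
  refine (measure_iUnion_le _).trans (ENNReal.tsum_le_tsum fun k => ?_)
  refine (measure_biUnion_finset_le _ _).trans ?_
  rw [← hKcard j, ← nsmul_eq_mul]
  exact Finset.sum_le_card_nsmul _ _ _ fun ν hν =>
    (hS.proj ν (hK1 j ν hν)).measure_exists_ge_le (hl j k) _

/-! ### Online regression -/

theorem transpose_design_mulVec_responses {Ω : Type*} {d : ℕ} (θ : EuclideanSpace ℝ (Fin d))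
    (X : ℕ → Ω → EuclideanSpace ℝ (Fin d)) (η Y : ℕ → Ω → ℝ)
    (hY : ∀ t, 1 ≤ t → ∀ ω, Y t ω = ⟪X t ω, θ⟫ + η t ω) (t : ℕ) (ω : Ω) :
    (design X t ω)ᵀ *ᵥ responses Y t ω
      = gram X t ω *ᵥ θ.ofLp + (residual X η t ω).ofLp := by
  have h1 : responses Y t ω = design X t ω *ᵥ θ.ofLp + fun s : Fin t => η (s + 1) ω := by
    ext s
    simp [responses, hY, design, Matrix.mulVec, dotProduct, PiLp.inner_apply, mul_comm]
  have h2 : (design X t ω)ᵀ *ᵥ (fun s : Fin t => η (s + 1) ω) = (residual X η t ω).ofLp := by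
    ext i
    simp only [Matrix.mulVec, dotProduct, Matrix.transpose_apply, design, Matrix.of_apply,
      residual, WithLp.ofLp_sum, Finset.sum_apply, PiLp.smul_apply, smul_eq_mul]
    rw [Fin.sum_univ_eq_sum_range (fun s => X (s + 1) ω i * η (s + 1) ω) t,
      Finset.range_eq_Ico, Finset.sum_Ico_add' (fun s => X s ω i * η s ω) 0 t 1]
    exact Finset.sum_congr rfl fun s _ => mul_comm _ _
  rw [h1, Matrix.mulVec_add, Matrix.mulVec_mulVec, gram_eq, h2]

/-- Decomposition of the estimation error into noise and shrinkage bias. -/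
theorem estimate_sub_eq {Ω : Type*} {d : ℕ} (θ : EuclideanSpace ℝ (Fin d))
    (X : ℕ → Ω → EuclideanSpace ℝ (Fin d)) (η Y : ℕ → Ω → ℝ)
    (hY : ∀ t, 1 ≤ t → ∀ ω, Y t ω = ⟪X t ω, θ⟫ + η t ω) {ρ : ℝ} (hρ : 0 < ρ) (t : ℕ) (ω : Ω)
    (hV : (gram X t ω).IsHermitian) :
    estimate ρ X Y t ω - θ
      = (vee (gram X t ω) ρ)⁻¹.toEuclideanLin (residual X η t ω)
        - ((vee (gram X t ω) ρ)⁻¹ * (vee (gram X t ω) ρ - gram X t ω)).toEuclideanLin θ := by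
  have hdet := isUnit_det_vee hV hρ
  refine WithLp.ofLp_injective 2 ?_
  rw [estimate, gram_eq, transpose_design_mulVec_responses θ X η Y hY]
  simp only [Matrix.toLpLin_apply, WithLp.ofLp_sub, Matrix.mulVec_add, Matrix.mul_sub,
    Matrix.nonsing_inv_mul _ hdet, Matrix.sub_mulVec, Matrix.one_mulVec, Matrix.mulVec_mulVec]
  abel

end OnlineRegression

open OnlineRegression in
theorem theorem5p1 {Ω : Type*} {mΩ : MeasurableSpace Ω} (P : Measure Ω) [IsProbabilityMeasure P]
    (ℱ : Filtration ℕ mΩ)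
    (lmax : EReal) (ψ : ℝ → ℝ) (hψ : IsCGFLike lmax ψ) (hψ_super : IsSuperGaussian lmax ψ)
    (hψ_steep : IsSteep lmax ψ)
    (d : ℕ) (hd : 1 ≤ d) (θ : EuclideanSpace ℝ (Fin d))
    (X : ℕ → Ω → EuclideanSpace ℝ (Fin d)) (η Y : ℕ → Ω → ℝ)
    (hmodel : IsOnlineRegression P ℱ lmax ψ θ X η Y)
    (α β ρ ε δ : ℝ) (hα : 1 < α) (hβ : 1 < β) (hρ : 0 < ρ)
    (hε : ε ∈ Set.Ioo (0 : ℝ) 1) (hδ : δ ∈ Set.Ioo (0 : ℝ) 1)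
    (h : ℝ → ℝ) (h_mono : MonotoneOn h (Set.Ici 0)) (h_pos : ∀ k : ℕ, 0 < h k)
    (h_summable : Summable fun k : ℕ => (h k)⁻¹) (h_sum : ∑' k : ℕ, (h k)⁻¹ ≤ 1) :
    P {ω | ∀ t, 1 ≤ t →
        ‖WithLp.toLp 2 (msqrt (vee (gram X t ω) ρ) *ᵥ (estimate ρ X Y t ω - θ).ofLp)‖
          < boundary lmax ψ α β ρ ε δ h (gram X t ω)
            + √ρ * ‖θ‖ * (if gammaMin (gram X t ω) < ρ then 1 else 0)}ᶜ
      ≤ ENNReal.ofReal δ := by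
  have hS := hmodel.subPsi
  refine le_trans (measure_mono (compl_subset_compl.2 ?_))
    (hS.measure_compl_norm_lt_boundary_le hψ hψ_super hψ_steep hd hα hβ hρ hε hδ h_mono h_pos
      h_summable h_sum)
  intro ω hω t _
  have hV := hS.posSemidef_V t ω
  have h1 := hω t
  have h2 := norm_shrinkage_bias_le hV hρ θ
  rw [← Matrix.toLpLin_apply, estimate_sub_eq θ X η Y hmodel.response hρ t ω hV.isHermitian,
    map_sub]
  exact (norm_sub_le _ _).trans_lt (add_lt_add_of_lt_of_le h1 h2)
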